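/- Let $\mathbb D=\{z\in\mathbb C:|z|<1\}$. Let $\mathscr A$ be the class of analytic functions $f$ in $\mathbb D$ with $f(0)=0$ and $f'(0)=1$, and let $\mathscr P_e$ be the class of analytic functions $p$ in $\mathbb D$ with $p(0)=1$ that are subordinate to the exponential function, that is, $p=e^{w}$ in $\mathbb D$ for some analytic $w:\mathbb D\to\mathbb D$ with $w(0)=0$. A function $f\in\mathscr A$ is called exponential convex if $1+zf''(z)/f'(z)$ belongs to $\mathscr P_e$, and exponential starlike if $zf'(z)/f(z)$ (extended by the value $1$ at $z=0$) belongs to $\mathscr P_e$. For $\mu,\nu$ such that neither $\mu+\nu$ nor $\mu-\nu$ is a negative odd integer, let $$s_{\mu,\nu}(z)=\frac{z^{\mu+1}}{(\mu-\nu+1)(\mu+\nu+1)}\;{}_1F_2\!\left(1;\tfrac{\mu-\nu+3}{2},\tfrac{\mu+\nu+3}{2};-\tfrac{z^2}{4}\right)$$ be the Lommel function of the first kind, let $$h_{\mu,\nu}(z)=(\mu-\nu+1)(\mu+\nu+1)\,z^{(1-\mu)/2}s_{\mu,\nu}(\sqrt z)=z+\sum_{n\ge1}\frac{(-1/4)^n}{\left(\frac{\mu-\nu+3}{2}\right)_n\left(\frac{\mu+\nu+3}{2}\right)_n}z^{n+1}\qquad(z\in\mathbb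 D)$$ be its normalization, where $(x)_n=x(x+1)\cdots(x+n-1)$, and let $f_{\mu,\nu}(z)=\int_0^z \frac{h_{\mu,\nu}(t)}{t}\,dt$ be the Alexander transform of $h_{\mu,\nu}$. **Theorem.** Let $\mu,\nu\in\mathbb R$ be such that neither $\mu+\nu$ nor $\mu-\nu$ is a negative odd integer, $$(\mu+1)\big((\mu+1)(\mu+3)-\nu^2\big)\ge\tfrac18$$ and $$\mu(2e-1)-\tfrac14e(e-1)\left|(\mu-1)^2-\nu^2\right|\ge e^3-e^2+\tfrac{13e}{4}-4 .$$ Then $f_{\mu,\nu}$ is exponential convex, and hence $h_{\mu,\nu}$ is exponential starlike. -/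

import Mathlib

namespace LommelExp

noncomputable section

/-- The open unit disk in `ℂ`. -/
def unitDisk : Set ℂ := Metric.ball 0 1

/-- `f ≺ g` in the unit disk: `f = g ∘ w` there, for some analytic `w` with `w 0 = 0` that maps
the disk into itself. -/
def Subordinate (f g : ℂ → ℂ) : Prop :=
  ∃ w : ℂ → ℂ, AnalyticOnNhd ℂ w unitDisk ∧ w 0 = 0 ∧
    (∀ z ∈ unitDisk, ‖w z‖ < 1) ∧ ∀ z ∈ unitDisk, f z = g (w z)

/-- The family `𝒫ₑ`: analytic functions `p` in the disk with `p 0 = 1` and `p ≺ exp`. -/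
def ClassPe (p : ℂ → ℂ) : Prop :=
  AnalyticOnNhd ℂ p unitDisk ∧ p 0 = 1 ∧ Subordinate p Complex.exp

/-- The class `𝒜` of analytic functions in the disk with `f 0 = f' 0 - 1 = 0`. -/
def ClassA (f : ℂ → ℂ) : Prop :=
  AnalyticOnNhd ℂ f unitDisk ∧ f 0 = 0 ∧ deriv f 0 = 1

/-- `f` is exponential convex: `f ∈ 𝒜` and `1 + z f''(z) / f'(z)` is (well defined and) in `𝒫ₑ`. -/
def ExpConvex (f : ℂ → ℂ) : Prop :=
  ClassA f ∧ (∀ z ∈ unitDisk, deriv f z ≠ 0) ∧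
    ClassPe (fun z => 1 + z * deriv (deriv f) z / deriv f z)

/-- `f` is exponential starlike: `f ∈ 𝒜` and `z f'(z) / f(z)` is in `𝒫ₑ`. The quotient has a
removable singularity at the origin, so membership in `𝒫ₑ` is asked of an extension `p`. -/
def ExpStarlike (f : ℂ → ℂ) : Prop :=
  ClassA f ∧ (∀ z ∈ unitDisk, z ≠ 0 → f z ≠ 0) ∧
    ∃ p : ℂ → ℂ, ClassPe p ∧ ∀ z ∈ unitDisk, z ≠ 0 → p z = z * deriv f z / f z

/-- The Pochhammer symbol `(x)ₙ = x (x + 1) ⋯ (x + n - 1)`. -/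
def pochhammer (x : ℂ) (n : ℕ) : ℂ := (ascPochhammer ℂ n).eval x

/-- The hypergeometric function `₁F₂(a; b, c; z)`, for `b, c ∉ {0, -1, -2, …}`. -/
def hyp1F2 (a b c z : ℂ) : ℂ :=
  ∑' n : ℕ, pochhammer a n / (pochhammer b n * pochhammer c n) * (z ^ n / (n.factorial : ℂ))

/-- The Lommel function of the first kind `s_{μ,ν}`, where neither of `μ ± ν` is a negative odd
integer (powers are principal values). -/
def lommelS (μ ν z : ℂ) : ℂ :=
  z ^ (μ + 1) / ((μ - ν + 1) * (μ + ν + 1)) *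
    hyp1F2 1 ((μ - ν + 3) / 2) ((μ + ν + 3) / 2) (-(z ^ 2) / 4)

/-- The normalized Lommel function
`h_{μ,ν}(z) = (μ - ν + 1) (μ + ν + 1) z ^ ((1 - μ) / 2) s_{μ,ν}(√z)`. -/
def lommelH (μ ν z : ℂ) : ℂ :=
  (μ - ν + 1) * (μ + ν + 1) * z ^ ((1 - μ) / 2) * lommelS μ ν (z ^ (1 / 2 : ℂ))

/-- The Alexander transform `∫₀ᶻ f(t) / t dt`, the integral being taken along the segment
`t = s z`, `0 ≤ s ≤ 1`. -/
def alexander (f : ℂ → ℂ) (z : ℂ) : ℂ :=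
  ∫ s in (0 : ℝ)..1, f (s * z) / (s * z) * z

end

end LommelExp

/-!
If `h = z G` in the disk, then `f = ∫ h / t` has `f' = G`, so `1 + z f'' / f' = 1 + z G' / G`. The
exponential maps the unit disk onto a region containing the disk of radius `1 - 1 / e` about `1`,
so it suffices that `‖z G'‖ < (1 - 1 / e) ‖G‖`. For the Lommel function, the two Pochhammer symbols
in the denominators of `G` have parameters with product `((μ + 3) ^ 2 - ν ^ 2) / 4`, so when this
has modulus at least `5 / 4` the `n`-th coefficient of `G` is at most `5 ^ (-n)`. Comparison with a
geometric series then gives `‖G - 1‖ ≤ 1 / 4` and `‖z G'‖ ≤ 5 / 16`.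
-/

namespace LommelExp

open Metric

section Subordination

theorem zero_mem_unitDisk : (0 : ℂ) ∈ unitDisk := mem_ball_self one_pos

theorem norm_log_one_add_le_neg_log_one_sub_norm {u : ℂ} (hu : ‖u‖ < 1) :
    ‖Complex.log (1 + u)‖ ≤ -Real.log (1 - ‖u‖) := by
  have hcomplex := Complex.hasSum_taylorSeries_neg_log (z := -u) (by rwa [norm_neg])
  have hreal : HasSum (fun n : ℕ => ‖u‖ ^ n / n) (-Real.log (1 - ‖u‖)) := by
    have h := Complex.hasSum_taylorSeries_neg_log (z := (‖u‖ : ℂ)) (by simpa using hu)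
    rw [← Complex.ofReal_one, ← Complex.ofReal_sub, ← Complex.ofReal_log (by linarith),
      ← Complex.ofReal_neg] at h
    exact_mod_cast h
  rw [sub_neg_eq_add] at hcomplex
  rw [← norm_neg]
  exact hcomplex.norm_le_of_bounded hreal fun n => by simp

theorem ClassPe.congr {p q : ℂ → ℂ} (hp : ClassPe p) (h : ∀ z ∈ unitDisk, p z = q z) :
    ClassPe q := by
  obtain ⟨ha, h0, w, hw, hw0, hlt, heq⟩ := hp
  refine ⟨ha.congr isOpen_ball h, ?_, w, hw, hw0, hlt, fun z hz => (h z hz).symm.trans (heq z hz)⟩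
  rw [← h 0 zero_mem_unitDisk, h0]

theorem classPe_one_add {u : ℂ → ℂ} (hu : AnalyticOnNhd ℂ u unitDisk) (h0 : u 0 = 0)
    (hlt : ∀ z ∈ unitDisk, ‖u z‖ < 1 - Real.exp (-1)) : ClassPe (fun z => 1 + u z) := by
  have hlt_one : ∀ z ∈ unitDisk, ‖u z‖ < 1 := fun z hz => by
    linarith [hlt z hz, Real.exp_pos (-1)]
  have hslit : ∀ z ∈ unitDisk, 1 + u z ∈ Complex.slitPlane := fun z hz =>
    Complex.mem_slitPlane_of_norm_lt_one (hlt_one z hz)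
  have ha : AnalyticOnNhd ℂ (fun z => 1 + u z) unitDisk := analyticOnNhd_const.add hu
  refine ⟨ha, by simp [h0], fun z => Complex.log (1 + u z), fun z hz => (ha z hz).clog (hslit z hz),
    by simp [h0], fun z hz => ?_,
    fun z hz => (Complex.exp_log (Complex.slitPlane_ne_zero (hslit z hz))).symm⟩
  have hlog : -1 < Real.log (1 - ‖u z‖) :=
    (Real.lt_log_iff_exp_lt (by linarith [hlt_one z hz])).2 (by linarith [hlt z hz])
  linarith [norm_log_one_add_le_neg_log_one_sub_norm (hlt_one z hz)]

theorem classPe_one_add_mul_logDeriv {G : ℂ → ℂ} (hG : DifferentiableOn ℂ G unitDisk)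
    (hlt : ∀ z ∈ unitDisk, ‖z * deriv G z‖ < (1 - Real.exp (-1)) * ‖G z‖)
    (hne : ∀ z ∈ unitDisk, G z ≠ 0) : ClassPe (fun z => 1 + z * deriv G z / G z) := by
  have hGa : AnalyticOnNhd ℂ G unitDisk := hG.analyticOnNhd isOpen_ball
  refine classPe_one_add ((analyticOnNhd_id.mul hGa.deriv).div hGa hne) (by simp) fun z hz => ?_
  rw [norm_div, div_lt_iff₀ (norm_pos_iff.2 (hne z hz))]
  exact hlt z hz

end Subordination

section Alexander

theorem hasDerivAt_alexander {G h : ℂ → ℂ} {r : ℝ} (hG : DifferentiableOn ℂ G (ball 0 r))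
    (hh : ∀ z ∈ ball 0 r, h z = z * G z) {z : ℂ} (hz : z ∈ ball 0 r) :
    HasDerivAt (alexander h) (G z) z := by
  obtain ⟨F, hF0, hF⟩ := hG.isExactOn_ball.with_val_at 0 0
  suffices heq : ∀ w ∈ ball (0 : ℂ) r, alexander h w = F w from
    (hF z hz).congr_of_eventuallyEq (Filter.eventually_of_mem (isOpen_ball.mem_nhds hz) heq)
  intro w hw
  have hsegment : ∀ s ∈ Set.uIcc (0 : ℝ) 1, (s : ℂ) * w ∈ ball (0 : ℂ) r := fun s hs => by
    rw [Set.uIcc_of_le zero_le_one] at hs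
    rw [mem_ball_zero_iff] at hw ⊢
    rw [norm_mul, Complex.norm_real, Real.norm_of_nonneg hs.1]
    exact (mul_le_of_le_one_left (norm_nonneg w) hs.2).trans_lt hw
  have hprimitive : ∀ s ∈ Set.uIcc (0 : ℝ) 1,
      HasDerivAt (fun s : ℝ => F (s * w)) (G (s * w) * w) s := fun s hs => by
    have hline : HasDerivAt (fun s : ℝ => (s : ℂ) * w) w s := by
      simpa using (Complex.ofRealCLM.hasDerivAt (x := s)).mul_const w
    exact (hF _ (hsegment s hs)).comp s hline
  have hcont : ContinuousOn (fun s : ℝ => G (s * w) * w) (Set.uIcc 0 1) :=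
    (hG.continuousOn.comp (by fun_prop) hsegment).mul continuousOn_const
  have hintegrand : ∀ s ∈ Set.uIoo (0 : ℝ) 1, h (s * w) / (s * w) * w = G (s * w) * w := by
    intro s hs
    rcases eq_or_ne w 0 with rfl | hw0
    · simp
    · have hs0 : (s : ℂ) ≠ 0 := by
        rw [Set.uIoo_of_le zero_le_one] at hs
        exact Complex.ofReal_ne_zero.2 hs.1.ne'
      rw [hh _ (hsegment s (Set.uIoo_subset_uIcc_self hs)),
        mul_div_cancel_left₀ _ (mul_ne_zero hs0 hw0)]
  calc alexander h w = ∫ s in (0 : ℝ)..1, G (s * w) * w :=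
        intervalIntegral.integral_congr_uIoo hintegrand
    _ = F w := by
        rw [intervalIntegral.integral_eq_sub_of_hasDerivAt hprimitive hcont.intervalIntegrable]
        simp [hF0]

theorem expConvex_of_hasDerivAt {f G : ℂ → ℂ} (hf : ∀ z ∈ unitDisk, HasDerivAt f (G z) z)
    (hf0 : f 0 = 0) (hG0 : G 0 = 1) (hne : ∀ z ∈ unitDisk, G z ≠ 0)
    (hPe : ClassPe (fun z => 1 + z * deriv G z / G z)) : ExpConvex f := by
  have hderiv : ∀ z ∈ unitDisk, deriv f z = G z := fun z hz => (hf z hz).deriv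
  have hderiv₂ : ∀ z ∈ unitDisk, deriv (deriv f) z = deriv G z := fun z hz =>
    Filter.EventuallyEq.deriv_eq (Filter.eventually_of_mem (isOpen_ball.mem_nhds hz) hderiv)
  have hdiff : DifferentiableOn ℂ f unitDisk := fun z hz =>
    (hf z hz).differentiableAt.differentiableWithinAt
  refine ⟨⟨hdiff.analyticOnNhd isOpen_ball, hf0, ?_⟩, fun z hz => ?_, hPe.congr fun z hz => ?_⟩
  · rw [hderiv 0 zero_mem_unitDisk, hG0]
  · rw [hderiv z hz]
    exact hne z hz
  · rw [hderiv z hz, hderiv₂ z hz]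

theorem ExpConvex.expStarlike {f h : ℂ → ℂ} (hf : ExpConvex f)
    (hh : ∀ z ∈ unitDisk, h z = z * deriv f z) : ExpStarlike h := by
  obtain ⟨⟨hfa, -, hf'0⟩, hne, hPe⟩ := hf
  have hderiv : ∀ z ∈ unitDisk, deriv h z = deriv f z + z * deriv (deriv f) z := fun z hz => by
    have heq : h =ᶠ[nhds z] fun w => w * deriv f w :=
      Filter.eventually_of_mem (isOpen_ball.mem_nhds hz) hh
    simpa [heq.deriv_eq] using
      ((hasDerivAt_id' z).fun_mul (hfa z hz).deriv.differentiableAt.hasDerivAt).deriv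
  refine ⟨⟨(analyticOnNhd_id.mul hfa.deriv).congr isOpen_ball fun z hz => (hh z hz).symm, ?_, ?_⟩,
    fun z hz hz0 => ?_, _, hPe, fun z hz hz0 => ?_⟩
  · rw [hh 0 zero_mem_unitDisk, zero_mul]
  · rw [hderiv 0 zero_mem_unitDisk, hf'0, zero_mul, add_zero]
  · rw [hh z hz]
    exact mul_ne_zero hz0 (hne z hz)
  · have := hne z hz
    rw [hderiv z hz, hh z hz]
    field_simp

theorem expConvex_alexander_and_expStarlike {G h : ℂ → ℂ} (hG : DifferentiableOn ℂ G unitDisk)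
    (hG0 : G 0 = 1) (hne : ∀ z ∈ unitDisk, G z ≠ 0)
    (hlt : ∀ z ∈ unitDisk, ‖z * deriv G z‖ < (1 - Real.exp (-1)) * ‖G z‖)
    (hh : ∀ z ∈ unitDisk, h z = z * G z) : ExpConvex (alexander h) ∧ ExpStarlike h := by
  have hderiv : ∀ z ∈ unitDisk, HasDerivAt (alexander h) (G z) z := fun z hz =>
    hasDerivAt_alexander hG hh hz
  have hconvex : ExpConvex (alexander h) :=
    expConvex_of_hasDerivAt hderiv (by simp [alexander]) hG0 hne
      (classPe_one_add_mul_logDeriv hG hlt hne)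
  exact ⟨hconvex, hconvex.expStarlike fun z hz => by rw [(hderiv z hz).deriv, hh z hz]⟩

end Alexander

section PowerSeries

variable {a : ℕ → ℂ} {q : ℝ} {z : ℂ}

theorem norm_mul_pow_le (ha : ∀ n, ‖a n‖ ≤ q ^ n) (hz : z ∈ unitDisk) (n : ℕ) :
    ‖a n * z ^ n‖ ≤ q ^ n := by
  have hz1 : ‖z‖ < 1 := mem_ball_zero_iff.1 hz
  rw [norm_mul, norm_pow]
  exact (mul_le_of_le_one_right (norm_nonneg _) (pow_le_one₀ (norm_nonneg z) hz1.le)).trans (ha n)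

theorem differentiableOn_tsum_mul_pow (hq0 : 0 ≤ q) (hq1 : q < 1) (ha : ∀ n, ‖a n‖ ≤ q ^ n) :
    DifferentiableOn ℂ (fun z => ∑' n, a n * z ^ n) unitDisk :=
  Complex.differentiableOn_tsum_of_summable_norm (summable_geometric_of_lt_one hq0 hq1)
    (fun n => by fun_prop) isOpen_ball fun n _ hz => norm_mul_pow_le ha hz n

theorem norm_tsum_mul_pow_sub_coeff_zero_le (hq0 : 0 ≤ q) (hq1 : q < 1)
    (ha : ∀ n, ‖a n‖ ≤ q ^ n) (hz : z ∈ unitDisk) :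
    ‖∑' n, a n * z ^ n - a 0‖ ≤ q / (1 - q) := by
  have hgeom := hasSum_geometric_of_lt_one hq0 hq1
  have hsum := Summable.of_norm_bounded hgeom.summable (norm_mul_pow_le ha hz)
  rw [hsum.tsum_eq_zero_add, pow_zero, mul_one, add_sub_cancel_left]
  refine tsum_of_norm_bounded (hgeom.mul_left q) fun n => ?_
  rw [← pow_succ']
  exact norm_mul_pow_le ha hz (n + 1)

theorem norm_mul_deriv_tsum_mul_pow_le (hq0 : 0 ≤ q) (hq1 : q < 1) (ha : ∀ n, ‖a n‖ ≤ q ^ n)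
    (hz : z ∈ unitDisk) : ‖z * deriv (fun z => ∑' n, a n * z ^ n) z‖ ≤ q / (1 - q) ^ 2 := by
  have hderiv : HasSum (fun n => z * deriv (fun w => a n * w ^ n) z)
      (z * deriv (fun z => ∑' n, a n * z ^ n) z) :=
    (Complex.hasSum_deriv_of_summable_norm (summable_geometric_of_lt_one hq0 hq1)
      (fun n => by fun_prop) isOpen_ball (fun n _ hw => norm_mul_pow_le ha hw n) hz).mul_left z
  have hterm : ∀ n : ℕ, z * deriv (fun w => a n * w ^ n) z = n * (a n * z ^ n) := fun n => by
    cases n with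
    | zero => simp
    | succ n =>
      simp only [deriv_const_mul_field', deriv_pow_field, Nat.add_sub_cancel]
      ring
  have hgeom := hasSum_coe_mul_geometric_of_norm_lt_one
    (show ‖q‖ < 1 by rwa [Real.norm_of_nonneg hq0])
  refine hderiv.norm_le_of_bounded hgeom fun n => ?_
  rw [hterm, norm_mul, Complex.norm_natCast]
  exact mul_le_mul_of_nonneg_left (norm_mul_pow_le ha hz n) n.cast_nonneg

theorem expConvex_alexander_and_expStarlike_of_norm_coeff_le {h : ℂ → ℂ} (ha0 : a 0 = 1)
    (ha : ∀ n, ‖a n‖ ≤ (1 / 5) ^ n) (hh : ∀ z ∈ unitDisk, h z = z * ∑' n, a n * z ^ n) :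
    ExpConvex (alexander h) ∧ ExpStarlike h := by
  set G : ℂ → ℂ := fun z => ∑' n, a n * z ^ n with hGdef
  have hq0 : (0 : ℝ) ≤ 1 / 5 := by norm_num
  have hq1 : (1 / 5 : ℝ) < 1 := by norm_num
  have hG : DifferentiableOn ℂ G unitDisk := differentiableOn_tsum_mul_pow hq0 hq1 ha
  have hlow : ∀ z ∈ unitDisk, 3 / 4 ≤ ‖G z‖ := fun z hz => by
    have hsub : ‖G z - 1‖ ≤ 1 / 4 := by
      have := norm_tsum_mul_pow_sub_coeff_zero_le hq0 hq1 ha hz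
      rw [ha0] at this
      exact this.trans_eq (by norm_num)
    have := norm_sub_norm_le 1 (G z)
    rw [norm_one, norm_sub_rev] at this
    linarith
  have hne : ∀ z ∈ unitDisk, G z ≠ 0 := fun z hz => norm_pos_iff.1 (by linarith [hlow z hz])
  have hlt : ∀ z ∈ unitDisk, ‖z * deriv G z‖ < (1 - Real.exp (-1)) * ‖G z‖ := fun z hz => by
    have hexp : Real.exp (-1) < 1 / 2 := Real.exp_neg_one_lt_half
    calc ‖z * deriv G z‖ ≤ (1 / 5) / (1 - 1 / 5) ^ 2 :=
          norm_mul_deriv_tsum_mul_pow_le hq0 hq1 ha hz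
      _ < (1 - Real.exp (-1)) * (3 / 4) := by linarith
      _ ≤ (1 - Real.exp (-1)) * ‖G z‖ := by
          gcongr
          · linarith
          · exact hlow z hz
  have hG0 : G 0 = 1 := by
    simp only [hGdef]
    rw [tsum_eq_single 0 fun n hn => by simp [hn], pow_zero, mul_one, ha0]
  exact expConvex_alexander_and_expStarlike hG hG0 hne hlt hh

end PowerSeries

section Lommel

/-- The coefficient of `z ^ (n + 1)` in the Taylor expansion of the normalized Lommel function
`h_{μ,ν}`. -/
noncomputable def lommelCoeff (μ ν : ℂ) (n : ℕ) : ℂ :=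
  (-1 / 4) ^ n / (pochhammer ((μ - ν + 3) / 2) n * pochhammer ((μ + ν + 3) / 2) n)

theorem lommelCoeff_zero (μ ν : ℂ) : lommelCoeff μ ν 0 = 1 := by
  simp [lommelCoeff, pochhammer]

theorem norm_pow_le_norm_pochhammer {x : ℂ} (hx : 0 ≤ x.re) (n : ℕ) :
    ‖x‖ ^ n ≤ ‖pochhammer x n‖ := by
  have hshift : ∀ k : ℕ, ‖x‖ ≤ ‖x + k‖ := fun k => by
    have hk : (0 : ℝ) ≤ k := k.cast_nonneg
    rw [← sq_le_sq₀ (norm_nonneg _) (norm_nonneg _), Complex.sq_norm, Complex.sq_norm,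
      Complex.normSq_apply, Complex.normSq_apply]
    simp only [Complex.add_re, Complex.natCast_re, Complex.add_im, Complex.natCast_im, add_zero]
    nlinarith [mul_nonneg hx hk]
  induction n with
  | zero => simp [pochhammer]
  | succ n ih =>
    rw [pochhammer, ascPochhammer_succ_eval, norm_mul, pow_succ]
    exact mul_le_mul ih (hshift n) (norm_nonneg x) (norm_nonneg _)

theorem norm_lommelCoeff_le {μ ν : ℂ} (hre : |ν.re| ≤ μ.re + 3) (hne : (μ + 3) ^ 2 - ν ^ 2 ≠ 0)
    (n : ℕ) : ‖lommelCoeff μ ν n‖ ≤ (1 / ‖(μ + 3) ^ 2 - ν ^ 2‖) ^ n := by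
  obtain ⟨hre₁, hre₂⟩ := abs_le.1 hre
  set x := (μ - ν + 3) / 2 with hx
  set y := (μ + ν + 3) / 2 with hy
  have hx_re : 0 ≤ x.re := by simp [hx]; linarith
  have hy_re : 0 ≤ y.re := by simp [hy]; linarith
  have hprod : (μ + 3) ^ 2 - ν ^ 2 = 4 * (x * y) := by rw [hx, hy]; ring
  have hxy : 0 < ‖x‖ * ‖y‖ := by
    rw [← norm_mul]
    exact norm_pos_iff.2 fun h => hne (by rw [hprod, h, mul_zero])
  calc ‖lommelCoeff μ ν n‖ = (1 / 4) ^ n / (‖pochhammer x n‖ * ‖pochhammer y n‖) := by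
        simp [lommelCoeff, hx, hy]
    _ ≤ (1 / 4) ^ n / (‖x‖ ^ n * ‖y‖ ^ n) := by
        rw [← mul_pow]
        gcongr
        rw [mul_pow]
        gcongr
        · exact norm_pow_le_norm_pochhammer hx_re n
        · exact norm_pow_le_norm_pochhammer hy_re n
    _ = (1 / ‖(μ + 3) ^ 2 - ν ^ 2‖) ^ n := by
        rw [hprod, norm_mul, norm_mul, Complex.norm_ofNat, ← mul_pow, ← div_pow, div_div]

theorem hyp1F2_one_left (b c z : ℂ) :
    hyp1F2 1 b c z = ∑' n, z ^ n / (pochhammer b n * pochhammer c n) := by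
  refine tsum_congr fun n => ?_
  have hfact : (n.factorial : ℂ) ≠ 0 := by exact_mod_cast n.factorial_ne_zero
  rw [show pochhammer 1 n = n.factorial from ascPochhammer_eval_one ℂ n, div_mul_div_comm,
    mul_comm (n.factorial : ℂ), mul_div_mul_right _ _ hfact]

theorem cpow_half_cpow (z a : ℂ) : (z ^ (1 / 2 : ℂ)) ^ a = z ^ (a / 2) := by
  have him : (Complex.log z * (1 / 2 : ℂ)).im = z.arg / 2 := by
    rw [show (1 / 2 : ℂ) = ((1 / 2 : ℝ) : ℂ) by norm_num, Complex.im_mul_ofReal, Complex.log_im]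
    ring
  rw [← Complex.cpow_mul, one_div_mul_eq_div]
  · rw [him]
    linarith [Complex.neg_pi_lt_arg z, Real.pi_pos]
  · rw [him]
    linarith [Complex.arg_le_pi z, Real.pi_pos]

theorem cpow_mul_cpow_half_cpow (μ z : ℂ) :
    z ^ ((1 - μ) / 2) * (z ^ (1 / 2 : ℂ)) ^ (μ + 1) = z := by
  have hexp : (1 - μ) / 2 + (μ + 1) / 2 = 1 := by ring
  rw [cpow_half_cpow]
  rcases eq_or_ne z 0 with rfl | hz
  -- The two exponents add up to `1`, so they cannot both vanish and give `0 ^ 0 = 1`.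
  · rcases eq_or_ne ((μ + 1) / 2) 0 with h | h
    · rw [h, add_zero] at hexp
      simp [hexp]
    · rw [Complex.zero_cpow h, mul_zero]
  · rw [← Complex.cpow_add _ _ hz, hexp, Complex.cpow_one]

theorem lommelH_eq_mul_tsum {μ ν : ℂ} (hadd : μ + ν ≠ -1) (hsub : μ - ν ≠ -1) (z : ℂ) :
    lommelH μ ν z = z * ∑' n, lommelCoeff μ ν n * z ^ n := by
  have hsub' : μ - ν + 1 ≠ 0 := fun h => hsub (eq_neg_of_add_eq_zero_left h)
  have hadd' : μ + ν + 1 ≠ 0 := fun h => hadd (eq_neg_of_add_eq_zero_left h)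
  have hsq : (z ^ (1 / 2 : ℂ)) ^ 2 = z := by
    rw [one_div]
    exact Complex.cpow_ofNat_inv_pow z 2
  have hseries : hyp1F2 1 ((μ - ν + 3) / 2) ((μ + ν + 3) / 2) (-z / 4) =
      ∑' n, lommelCoeff μ ν n * z ^ n := by
    rw [hyp1F2_one_left]
    refine tsum_congr fun n => ?_
    rw [lommelCoeff, div_mul_eq_mul_div, ← mul_pow]
    ring_nf
  calc lommelH μ ν z = z ^ ((1 - μ) / 2) * (z ^ (1 / 2 : ℂ)) ^ (μ + 1) *
        hyp1F2 1 ((μ - ν + 3) / 2) ((μ + ν + 3) / 2) (-z / 4) := by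
        rw [lommelH, lommelS, hsq]
        field_simp
    _ = z * ∑' n, lommelCoeff μ ν n * z ^ n := by rw [cpow_mul_cpow_half_cpow, hseries]

end Lommel

section Parameters

theorem pos_of_cubic_le {e μ A : ℝ} (he : 2 ≤ e) (hA : 0 ≤ A)
    (h : e ^ 3 - e ^ 2 + 13 * e / 4 - 4 ≤ μ * (2 * e - 1) - 1 / 4 * e * (e - 1) * A) :
    0 < μ := by
  have hprod : 0 ≤ 1 / 4 * e * (e - 1) * A :=
    mul_nonneg (mul_nonneg (by linarith) (by linarith)) hA
  have hcubic : 0 < e ^ 2 * (e - 1) := mul_pos (by positivity) (by linarith)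
  exact pos_of_mul_pos_left (by linarith : 0 < μ * (2 * e - 1)) (by linarith)

theorem abs_le_and_five_le_norm_sq_sub_sq {μ ν : ℝ} (hμ : -1 < μ)
    (h : 1 / 8 ≤ (μ + 1) * ((μ + 1) * (μ + 3) - ν ^ 2)) :
    |ν| ≤ μ + 3 ∧ 5 ≤ ‖((μ : ℂ) + 3) ^ 2 - (ν : ℂ) ^ 2‖ := by
  have hfive : 5 ≤ (μ + 3) ^ 2 - ν ^ 2 := by
    refine le_of_mul_le_mul_left ?_ (by linarith : 0 < μ + 1)
    -- With `t = μ + 1`, the right side is at least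
    -- `1 / 8 + 4 t + 2 t ^ 2 = 5 t + 2 (t - 1 / 4) ^ 2`.
    linarith [sq_nonneg (μ + 1 - 1 / 4)]
  exact ⟨abs_le_of_sq_le_sq (by linarith) (by linarith),
    by exact_mod_cast hfive.trans (le_abs_self _)⟩

end Parameters

end LommelExp

theorem theorem3p2_general {μ ν : ℂ} (hadd : μ + ν ≠ -1) (hsub : μ - ν ≠ -1)
    (hre : |ν.re| ≤ μ.re + 3) (hnorm : 5 ≤ ‖(μ + 3) ^ 2 - ν ^ 2‖) :
    LommelExp.ExpConvex (LommelExp.alexander (LommelExp.lommelH μ ν)) ∧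
      LommelExp.ExpStarlike (LommelExp.lommelH μ ν) := by
  have hne : (μ + 3) ^ 2 - ν ^ 2 ≠ 0 := norm_pos_iff.1 (by linarith)
  have hcoeff : ∀ n, ‖LommelExp.lommelCoeff μ ν n‖ ≤ (1 / 5) ^ n := fun n =>
    (LommelExp.norm_lommelCoeff_le hre hne n).trans (by gcongr)
  exact LommelExp.expConvex_alexander_and_expStarlike_of_norm_coeff_le
    (LommelExp.lommelCoeff_zero μ ν) hcoeff fun z _ => LommelExp.lommelH_eq_mul_tsum hadd hsub z

theorem theorem3p2 (μ ν : ℝ)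
    (hadd : ∀ k : ℕ, μ + ν ≠ -(2 * (k : ℝ) + 1))
    (hsub : ∀ k : ℕ, μ - ν ≠ -(2 * (k : ℝ) + 1))
    (h₁ : (μ + 1) * ((μ + 1) * (μ + 3) - ν ^ 2) ≥ 1 / 8)
    (h₂ : μ * (2 * Real.exp 1 - 1)
        - 1 / 4 * Real.exp 1 * (Real.exp 1 - 1) * |(μ - 1) ^ 2 - ν ^ 2|
      ≥ Real.exp 1 ^ 3 - Real.exp 1 ^ 2 + 13 * Real.exp 1 / 4 - 4) :
    LommelExp.ExpConvex (LommelExp.alexander (LommelExp.lommelH μ ν)) ∧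
      LommelExp.ExpStarlike (LommelExp.lommelH μ ν) := by
  have hμ : 0 < μ :=
    LommelExp.pos_of_cubic_le Real.exp_one_gt_two.le (abs_nonneg _) h₂
  obtain ⟨hre, hnorm⟩ := LommelExp.abs_le_and_five_le_norm_sq_sub_sq (by linarith) h₁
  exact theorem3p2_general (by exact_mod_cast (by simpa using hadd 0 : μ + ν ≠ -1))
    (by exact_mod_cast (by simpa using hsub 0 : μ - ν ≠ -1)) hre hnorm
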